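/- An EMV-algebra is an algebra $(M;\vee,\wedge,\oplus,0)$ such that (i) $(M;\vee,\wedge,0)$ is a distributive lattice with bottom element $0$; (ii) $(M;\oplus,0)$ is a commutative ordered monoid with neutral element $0$, i.e. $x\le y$ implies $x\oplus z\le y\oplus z$, where $\le$ is the lattice order; (iii) for each idempotent $a$ (i.e. $a\oplus a=a$), the minimum $\lambda_a(x)=\min\{z\in[0,a]: z\oplus x=a\}$ exists for every $x\in[0,a]$, and $([0,a];\oplus,\lambda_a,0,a)$ is an MV-algebra; (iv) for each $x\in M$ there is an idempotent $a$ with $x\le a$. For $x,y\in M$ put $x\odot y=\lambda_a(\lambda_a(x)\oplus\lambda_a(y))$, where $a$ is any idempotent with $x,y\le a$ (the value does not depend on $a$). The partial sum $x+y$ is defined iff $x\odot y=0$, and then $x+y=x\oplus y$. A state on $M$ is a map $s:M\to[0,1]$ such that $s(x+y)=s(x)+s(y)$ whenever $x+y$ is defined, and $s(a)=1$ for some $a\in M$. Let $\mathcal S(M)$ be the set of states. A state $s$ is extremal if $s=\lambda s_1+(1-\lambda)s_2$ with $s_1,s_2\in\mathcal S(M)$ and $\lambda\in(0,1)$ implies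 $s=s_1=s_2$; let $\partial\mathcal S(M)$ be the set of extremal states. An EMV-homomorphism is a map $f$ between EMV-algebras that preserves $\vee,\wedge,\oplus,0$ and satisfies $f(\lambda_b(x))=\lambda_{f(b)}(f(x))$ for all idempotents $b$ and $x\le b$. A state-morphism on $M$ is an EMV-homomorphism $s$ from $M$ into the real interval $[0,1]$ (with its usual order and $x\oplus y=\min\{x+y,1\}$) such that $s(a)=1$ for some $a\in M$; let $\mathcal{SM}(M)$ be the set of state-morphisms. An ideal of $M$ is a non-empty down-set closed under $\oplus$; a maximal ideal is a proper ideal not properly contained in another proper ideal. Theorem. Let $M$ be an EMV-algebra. Then $\partial\mathcal S(M)=\mathcal{SM}(M)$. Moreover, a state $s$ on $M$ is extremal if and only if its kernel $\{x\in M: s(x)=0\}$ is a maximal ideal of $M$. -/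

import Mathlib

/-- `(S; add, star, zero, one)` is an MV-algebra, where `S` is a subset of an ambient type: `S` is
closed under the operations and the axioms of MV-algebras hold on `S`. -/
structure IsMVAlgebraOn {A : Type*} (S : Set A) (add : A → A → A) (star : A → A)
    (zero one : A) : Prop where
  zero_mem : zero ∈ S
  one_mem : one ∈ S
  add_mem : ∀ x ∈ S, ∀ y ∈ S, add x y ∈ S
  star_mem : ∀ x ∈ S, star x ∈ S
  add_assoc : ∀ x ∈ S, ∀ y ∈ S, ∀ z ∈ S, add (add x y) z = add x (add y z)
  add_comm : ∀ x ∈ S, ∀ y ∈ S, add x y = add y x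
  add_zero : ∀ x ∈ S, add x zero = x
  star_zero : star zero = one
  star_star : ∀ x ∈ S, star (star x) = x
  add_one : ∀ x ∈ S, add x one = one
  lukasiewicz : ∀ x ∈ S, ∀ y ∈ S,
    add x (star (add x (star y))) = add y (star (add y (star x)))

/-- The signature of EMV-algebras: a distributive lattice with a binary operation `⊕ₑ` (the total
addition) and a constant `zero`. -/
class EMVData (M : Type*) extends DistribLattice M where
  oplus : M → M → M
  zero : M

namespace EMVData

infixl:65 " ⊕ₑ " => EMVData.oplus

variable {M : Type*} [EMVData M]

/-- Idempotent elements: `a ⊕ₑ a = a`. -/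
def IsIdem (a : M) : Prop := a ⊕ₑ a = a

open Classical in
/-- `lam a x = min {z ∈ [0, a] : z ⊕ₑ x = a}`; it is used for idempotents `a` and for `x ≤ a`
only, where the minimum exists in an EMV-algebra (value `zero` if there is no minimum). -/
noncomputable def lam (a x : M) : M :=
  if h : ∃ m : M, IsLeast {z : M | z ∈ Set.Icc zero a ∧ z ⊕ₑ x = a} m then h.choose else zero

/-- `lam a x` is the minimum as soon as there is one. -/
theorem lam_eq {a x m : M} (h : IsLeast {z : M | z ∈ Set.Icc zero a ∧ z ⊕ₑ x = a} m) :
    lam a x = m := by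
  have h' : ∃ m : M, IsLeast {z : M | z ∈ Set.Icc zero a ∧ z ⊕ₑ x = a} m := ⟨m, h⟩
  unfold lam
  rw [dif_pos h']
  exact h'.choose_spec.unique h

end EMVData

open EMVData in
/-- EMV-algebras. -/
class EMVAlgebra (M : Type*) extends EMVData M where
  /-- `(M; ⊕ₑ, 0, ≤)` is a commutative ordered monoid -/
  oplus_assoc : ∀ x y z : M, x ⊕ₑ y ⊕ₑ z = x ⊕ₑ (y ⊕ₑ z)
  oplus_comm : ∀ x y : M, x ⊕ₑ y = y ⊕ₑ x
  oplus_zero : ∀ x : M, x ⊕ₑ zero = x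
  oplus_mono : ∀ x y z : M, x ≤ y → x ⊕ₑ z ≤ y ⊕ₑ z
  /-- `zero` is the bottom element of the distributive lattice -/
  zero_le : ∀ x : M, zero ≤ x
  /-- for each idempotent `a`, the minima defining `lam a` exist on `[0, a]`, -/
  lam_isLeast : ∀ a x : M, IsIdem a → x ≤ a →
    IsLeast {z : M | z ∈ Set.Icc zero a ∧ z ⊕ₑ x = a} (lam a x)
  /-- and `([0, a]; ⊕ₑ, lam a, 0, a)` is an MV-algebra -/
  isMVAlgebraOn : ∀ a : M, IsIdem a → IsMVAlgebraOn (Set.Icc zero a) oplus (lam a) zero a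
  /-- each element lies below an idempotent -/
  exists_idem_ge : ∀ x : M, ∃ a : M, IsIdem a ∧ x ≤ a

namespace EMVAlgebra

open EMVData

section Operations

variable {M : Type*} [EMVAlgebra M]

/-- Any two elements lie below a common idempotent. -/
theorem exists_idem_ge_pair (x y : M) : ∃ a : M, IsIdem a ∧ x ≤ a ∧ y ≤ a := by
  obtain ⟨a, ha, h⟩ := exists_idem_ge (x ⊔ y)
  exact ⟨a, ha, le_sup_left.trans h, le_sup_right.trans h⟩

/-- `x ⊙ y = lam a (lam a x ⊕ₑ lam a y)` for any idempotent `a` with `x, y ≤ a`; by `odot_eq` below,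
the value does not depend on the choice of `a`. -/
noncomputable def odot (x y : M) : M :=
  let a := (exists_idem_ge_pair x y).choose
  lam a (lam a x ⊕ₑ lam a y)

theorem mem {a x : M} (h : x ≤ a) : x ∈ Set.Icc (zero : M) a := ⟨zero_le x, h⟩

theorem lam_le {a x : M} (ha : IsIdem a) (hx : x ≤ a) : lam a x ≤ a :=
  (lam_isLeast a x ha hx).1.1.2

theorem lam_oplus {a x : M} (ha : IsIdem a) (hx : x ≤ a) : lam a x ⊕ₑ x = a :=
  (lam_isLeast a x ha hx).1.2

theorem oplus_mono_right {x y z : M} (h : x ≤ y) : z ⊕ₑ x ≤ z ⊕ₑ y := by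
  rw [oplus_comm z x, oplus_comm z y]; exact oplus_mono _ _ _ h

theorem le_oplus_left (x y : M) : x ≤ x ⊕ₑ y := by
  have := oplus_mono_right (z := x) (zero_le y)
  rwa [oplus_zero] at this

theorem le_oplus_right (x y : M) : y ≤ x ⊕ₑ y := by
  rw [oplus_comm]; exact le_oplus_left y x

theorem oplus_le {a x y : M} (ha : IsIdem a) (hx : x ≤ a) (hy : y ≤ a) :
    x ⊕ₑ y ≤ a :=
  ((oplus_mono _ _ _ hx).trans (oplus_mono_right hy)).trans (le_of_eq ha)

theorem lam_le_of {a x z : M} (ha : IsIdem a) (hx : x ≤ a) (hz : z ≤ a)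
    (h : a ≤ z ⊕ₑ x) : lam a x ≤ z :=
  (lam_isLeast a x ha hx).2 ⟨mem hz, (oplus_le ha hz hx).antisymm h⟩

theorem lam_lam {a x : M} (ha : IsIdem a) (hx : x ≤ a) : lam a (lam a x) = x :=
  (isMVAlgebraOn a ha).star_star x (mem hx)

theorem lam_anti {a x y : M} (ha : IsIdem a) (hxy : x ≤ y) (hy : y ≤ a) :
    lam a y ≤ lam a x := by
  refine lam_le_of ha hy (lam_le ha (hxy.trans hy)) ?_
  calc a = lam a x ⊕ₑ x := (lam_oplus ha (hxy.trans hy)).symm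
    _ ≤ _ := oplus_mono_right hxy

theorem lam_top (a : M) : lam a a = zero :=
  lam_eq ⟨⟨mem (zero_le a), by rw [oplus_comm, oplus_zero]⟩, fun z _ => zero_le z⟩

/-- For idempotents `a ≤ c` and `x ≤ a`, the complements in `[0, a]` and `[0, c]` are related. -/
theorem lam_eq_oplus {a c x : M} (ha : IsIdem a) (hc : IsIdem c) (hxa : x ≤ a)
    (hac : a ≤ c) : lam c x = lam a x ⊕ₑ lam c a := by
  have hxc := hxa.trans hac
  have hca := lam_le hc hac
  have hcx := lam_le hc hxc
  have key : c ≤ a ⊕ₑ lam c x := by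
    calc c = lam c x ⊕ₑ x := (lam_oplus hc hxc).symm
      _ ≤ lam c x ⊕ₑ a := oplus_mono_right hxa
      _ = _ := oplus_comm _ _
  have key' : a ⊕ₑ lam c x = c := (oplus_le hc hac hcx).antisymm key
  have hw : x ⊕ₑ lam c a ≤ c := oplus_le hc hxc hca
  apply le_antisymm
  · refine lam_le_of hc hxc (oplus_le hc ((lam_le ha hxa).trans hac) hca) (le_of_eq ?_)
    rw [oplus_assoc, oplus_comm (lam c a), ← oplus_assoc, lam_oplus ha hxa, oplus_comm,
      lam_oplus hc hac]
  · have h1 : lam a x ≤ lam c (x ⊕ₑ lam c a) := by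
      refine lam_le_of ha hxa ?_ ?_
      · calc lam c (x ⊕ₑ lam c a) ≤ lam c (lam c a) := lam_anti hc (le_oplus_right _ _) hw
          _ = a := lam_lam hc hac
      · have h := (isMVAlgebraOn c hc).lukasiewicz x (mem hxc) a (mem hac)
        rw [key', lam_top c, oplus_zero] at h
        rw [oplus_comm, h]
    calc lam a x ⊕ₑ lam c a ≤ lam c (x ⊕ₑ lam c a) ⊕ₑ lam c a := oplus_mono _ _ _ h1
      _ = lam c a ⊕ₑ lam c (lam c a ⊕ₑ lam c (lam c x)) := by
        rw [lam_lam hc hxc, oplus_comm, oplus_comm (lam c a) x]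
      _ = lam c x ⊕ₑ lam c (lam c x ⊕ₑ lam c (lam c a)) :=
        (isMVAlgebraOn c hc).lukasiewicz _ (mem hca) _ (mem hcx)
      _ = lam c x := by
        rw [lam_lam hc hac, oplus_comm (lam c x) a, key', lam_top c, oplus_zero]
      _ ≤ lam c x := le_rfl

theorem odot_aux {a c x y : M} (ha : IsIdem a) (hc : IsIdem c) (hx : x ≤ a) (hy : y ≤ a)
    (hac : a ≤ c) : lam c (lam c x ⊕ₑ lam c y) = lam a (lam a x ⊕ₑ lam a y) := by
  have hca := lam_le hc hac
  have hxa := lam_le ha hx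
  have hya := lam_le ha hy
  have hw : lam a x ⊕ₑ lam a y ≤ a := oplus_le ha hxa hya
  have idem : lam c a ⊕ₑ lam c a = lam c a := by
    refine le_antisymm ?_ (le_oplus_left _ _)
    have h := (isMVAlgebraOn c hc).lukasiewicz (lam c a) (mem hca) a (mem hac)
    have haa : a ⊕ₑ a = a := ha
    rw [lam_lam hc hac, haa, oplus_comm a, lam_oplus hc hac] at h
    have h2 := oplus_le hc hca hca
    have h3 := lam_le_of hc (lam_le hc h2) hca (le_of_eq h.symm)
    rwa [lam_lam hc h2] at h3
  have h1 : lam c x ⊕ₑ lam c y = lam c (lam a (lam a x ⊕ₑ lam a y)) := by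
    rw [lam_eq_oplus ha hc hx hac, lam_eq_oplus ha hc hy hac,
      lam_eq_oplus ha hc (lam_le ha hw) hac, lam_lam ha hw]
    calc lam a x ⊕ₑ lam c a ⊕ₑ (lam a y ⊕ₑ lam c a)
        = lam a x ⊕ₑ lam a y ⊕ₑ (lam c a ⊕ₑ lam c a) := by
          rw [oplus_assoc, ← oplus_assoc (lam c a), oplus_comm (lam c a) (lam a y),
            oplus_assoc (lam a y), ← oplus_assoc]
      _ = _ := by rw [idem]
  rw [h1, lam_lam hc ((lam_le ha hw).trans hac)]

/-- The operation `⊙` can be computed in any interval `[0, a]` containing both arguments. -/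
theorem odot_eq {a x y : M} (ha : IsIdem a) (hx : x ≤ a) (hy : y ≤ a) :
    odot x y = lam a (lam a x ⊕ₑ lam a y) := by
  obtain ⟨hb, hxb, hyb⟩ := (exists_idem_ge_pair x y).choose_spec
  obtain ⟨c, hc, hac, hbc⟩ := exists_idem_ge_pair a (exists_idem_ge_pair x y).choose
  exact (odot_aux hb hc hxb hyb hbc).symm.trans (odot_aux ha hc hx hy hac)

/-- The partial addition `x + y` is defined iff `x ⊙ y = 0`, and then `x + y = x ⊕ₑ y`. -/
def SumDefined (x y : M) : Prop := odot x y = zero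

/-- Ideals of an EMV-algebra. -/
structure IsIdeal (I : Set M) : Prop where
  nonempty : I.Nonempty
  lower : ∀ x y : M, x ≤ y → y ∈ I → x ∈ I
  oplus_mem : ∀ x y : M, x ∈ I → y ∈ I → x ⊕ₑ y ∈ I

/-- Maximal ideals: proper ideals not properly contained in another proper ideal. -/
structure IsMaximalIdeal (I : Set M) : Prop where
  isIdeal : IsIdeal I
  ne_univ : I ≠ Set.univ
  eq_of_subset : ∀ J : Set M, IsIdeal J → J ≠ Set.univ → I ⊆ J → J = I

end Operations

/-- EMV-homomorphisms. -/
structure IsEMVHom {M N : Type*} [EMVAlgebra M] [EMVAlgebra N] (f : M → N) : Prop where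
  map_sup : ∀ x y : M, f (x ⊔ y) = f x ⊔ f y
  map_inf : ∀ x y : M, f (x ⊓ y) = f x ⊓ f y
  map_oplus : ∀ x y : M, f (x ⊕ₑ y) = f x ⊕ₑ f y
  map_zero : f zero = zero
  map_lam : ∀ b x : M, IsIdem b → x ≤ b → f (lam b x) = lam (f b) (f x)

/-- The real unit interval `[0, 1]` with its usual order and `x ⊕ₑ y = min {x + y, 1}`. -/
noncomputable instance unitIntervalEMVData : EMVData unitInterval where
  oplus x y := ⟨min ((x : ℝ) + y) 1, le_min (add_nonneg x.2.1 y.2.1) zero_le_one, min_le_right _ _⟩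
  zero := 0

theorem coe_oplus (x y : unitInterval) :
    ((x ⊕ₑ y : unitInterval) : ℝ) = min ((x : ℝ) + y) 1 :=
  rfl

theorem unit_zero : (zero : unitInterval) = 0 := rfl

theorem unit_idem {a : unitInterval} (ha : IsIdem a) : a = 0 ∨ a = 1 := by
  have h : min ((a : ℝ) + a) 1 = a := congrArg Subtype.val ha
  rcases min_choice ((a : ℝ) + a) 1 with h1 | h1
  · left; apply Subtype.ext; rw [h1] at h; rw [Set.Icc.coe_zero]; linarith
  · right; apply Subtype.ext; rw [h1] at h; rw [Set.Icc.coe_one]; linarith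

theorem unit_isLeast_one (x : unitInterval) :
    IsLeast {z : unitInterval | z ∈ Set.Icc zero 1 ∧ z ⊕ₑ x = 1} (unitInterval.symm x) := by
  refine ⟨⟨⟨unitInterval.nonneg', unitInterval.le_one'⟩, ?_⟩, ?_⟩
  · ext; rw [coe_oplus]; simp
  · rintro z ⟨-, hz⟩
    have h : min ((z : ℝ) + x) 1 = 1 := congrArg Subtype.val hz
    have h2 := min_eq_right_iff.1 h
    rw [← Subtype.coe_le_coe, unitInterval.coe_symm_eq]
    linarith

theorem unit_lam_one (x : unitInterval) : lam 1 x = unitInterval.symm x :=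
  lam_eq (unit_isLeast_one x)

theorem unit_isLeast_zero :
    IsLeast {z : unitInterval | z ∈ Set.Icc zero 0 ∧ z ⊕ₑ 0 = 0} 0 := by
  refine ⟨⟨⟨le_rfl, le_rfl⟩, ?_⟩, fun z _ => unitInterval.nonneg'⟩
  ext; rw [coe_oplus]; simp

theorem unit_zero_oplus : (0 : unitInterval) ⊕ₑ 0 = 0 := unit_isLeast_zero.1.2

theorem unit_lam_zero : lam (0 : unitInterval) 0 = 0 := lam_eq unit_isLeast_zero

theorem unit_assoc (x y z : unitInterval) : x ⊕ₑ y ⊕ₑ z = x ⊕ₑ (y ⊕ₑ z) := by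
  have hx := x.2.1
  have hz := z.2.1
  ext
  simp only [coe_oplus]
  grind

theorem unit_comm (x y : unitInterval) : x ⊕ₑ y = y ⊕ₑ x := by
  ext; simp only [coe_oplus]; rw [add_comm]

theorem unit_add_zero (x : unitInterval) : x ⊕ₑ zero = x := by
  ext; rw [coe_oplus, unit_zero]; simpa using x.2.2

/-- The EMV-algebra of the real unit interval. -/
noncomputable instance unitIntervalEMVAlgebra : EMVAlgebra unitInterval where
  oplus_assoc := unit_assoc
  oplus_comm := unit_comm
  oplus_zero := unit_add_zero
  oplus_mono x y z h := by
    rw [← Subtype.coe_le_coe] at h ⊢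
    rw [coe_oplus, coe_oplus]
    gcongr
  zero_le x := unitInterval.nonneg'
  lam_isLeast a x ha hx := by
    rcases unit_idem ha with rfl | rfl
    · obtain rfl : x = 0 := le_antisymm hx unitInterval.nonneg'
      rw [unit_lam_zero]
      exact unit_isLeast_zero
    · rw [unit_lam_one]
      exact unit_isLeast_one x
  isMVAlgebraOn a ha := by
    rcases unit_idem ha with rfl | rfl
    · have h0 : ∀ x ∈ Set.Icc (zero : unitInterval) 0, x = 0 := fun x hx => le_antisymm hx.2 hx.1
      refine ⟨⟨le_rfl, le_rfl⟩, ⟨le_rfl, le_rfl⟩, ?_, ?_, fun x _ y _ z _ => unit_assoc x y z,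
        fun x _ y _ => unit_comm x y, fun x _ => unit_add_zero x, unit_lam_zero, ?_, ?_, ?_⟩
      · intro x hx y hy
        rw [h0 x hx, h0 y hy, unit_zero_oplus]
        exact ⟨le_rfl, le_rfl⟩
      · intro x hx
        rw [h0 x hx, unit_lam_zero]
        exact ⟨le_rfl, le_rfl⟩
      · intro x hx
        rw [h0 x hx, unit_lam_zero, unit_lam_zero]
      · intro x hx
        rw [h0 x hx, unit_zero_oplus]
      · intro x hx y hy
        rw [h0 x hx, h0 y hy]
    · have h1 : ∀ x : unitInterval, x ∈ Set.Icc (zero : unitInterval) 1 :=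
        fun x => ⟨unitInterval.nonneg', unitInterval.le_one'⟩
      refine ⟨h1 _, h1 _, fun _ _ _ _ => h1 _, fun _ _ => h1 _,
        fun x _ y _ z _ => unit_assoc x y z, fun x _ y _ => unit_comm x y,
        fun x _ => unit_add_zero x, ?_, ?_, ?_, ?_⟩
      · rw [unit_lam_one, unit_zero, unitInterval.symm_zero]
      · intro x _
        rw [unit_lam_one, unit_lam_one, unitInterval.symm_symm]
      · intro x _
        ext; rw [coe_oplus]; simpa using x.2.1
      · intro x _ y _
        simp only [unit_lam_one]
        ext
        simp only [coe_oplus, unitInterval.coe_symm_eq]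
        have hx := x.2.1
        have hx' := x.2.2
        have hy := y.2.1
        have hy' := y.2.2
        grind
  exists_idem_ge x := ⟨1, by unfold IsIdem; ext; rw [coe_oplus]; simp, unitInterval.le_one'⟩

section States

variable (M : Type*) [EMVAlgebra M]

/-- The set `S(M)` of states on `M`. -/
def states : Set (M → unitInterval) :=
  {s | (∀ x y : M, SumDefined x y → (s (x ⊕ₑ y) : ℝ) = s x + s y) ∧ ∃ a : M, s a = 1}

/-- The set `SM(M)` of state-morphisms on `M`. -/
def stateMorphisms : Set (M → unitInterval) :=
  {s | IsEMVHom s ∧ ∃ a : M, s a = 1}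

/-- The set `∂S(M)` of extremal states on `M`. -/
def extremalStates : Set (M → unitInterval) :=
  {s | s ∈ states M ∧ ∀ s₁ ∈ states M, ∀ s₂ ∈ states M, ∀ t : ℝ, t ∈ Set.Ioo (0 : ℝ) 1 →
    (∀ x : M, (s x : ℝ) = t * s₁ x + (1 - t) * s₂ x) → s = s₁ ∧ s = s₂}

variable {M}

/-- The kernel of a `[0, 1]`-valued mapping. -/
def ker (s : M → unitInterval) : Set M := {x | s x = 0}

end States

end EMVAlgebra

/-! The link between the three notions is primeness of the kernel: `x ⊓ y = zero` forces `s x = 0`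
or `s y = 0`. An extremal state has prime kernel: `exists_component` cuts out of `s` an additive
part `f ≤ s` with `f x = s x` that vanishes on everything disjoint from `x`. By
`exists_eq_mul_of_le`, `f` is a multiple of `s`, so `s` cannot be nonzero at both `x` and `y`.
Maximal ideals are prime as well (`IsMaximalIdeal.mem_or_mem`). Primeness makes a state a
state-morphism: `x` and `y` have disjoint remainders over `x ⊓ y`, one of which is null, so `s`
preserves meets, and the other operations follow. Conversely, a state-morphism is determined among
states by its kernel (`eq_of_ker_subset`), and both parts of a convex decomposition vanish on that
kernel, which gives extremality. Its kernel is maximal because `[0, 1]` is Archimedean. -/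

namespace EMVAlgebra

open EMVData Filter Topology

/-! ### Arithmetic of partial sums, differences and meets -/

section Arithmetic

variable {M : Type*} [EMVAlgebra M]

theorem eq_zero_of_le {x : M} (h : x ≤ zero) : x = zero := h.antisymm (zero_le x)

theorem isIdem_zero : IsIdem (zero : M) := oplus_zero zero

theorem oplus_mono_both {x y x' y' : M} (h : x ≤ x') (h' : y ≤ y') : x ⊕ₑ y ≤ x' ⊕ₑ y' :=
  (oplus_mono _ _ _ h).trans (oplus_mono_right h')

theorem lam_zero {a : M} (ha : IsIdem a) : lam a zero = a := by
  have := lam_oplus ha (zero_le a)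
  rwa [oplus_zero] at this

theorem lam_le_iff {a x z : M} (ha : IsIdem a) (hx : x ≤ a) (hz : z ≤ a) :
    lam a x ≤ z ↔ z ⊕ₑ x = a := by
  refine ⟨fun h => (oplus_le ha hz hx).antisymm ?_, fun h => lam_le_of ha hx hz h.ge⟩
  calc a = lam a x ⊕ₑ x := (lam_oplus ha hx).symm
    _ ≤ z ⊕ₑ x := oplus_mono _ _ _ h

theorem le_lam_comm {a x y : M} (ha : IsIdem a) (hx : x ≤ a) (h : y ≤ lam a x) :
    x ≤ lam a y := by
  have := lam_anti ha h (lam_le ha hx)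
  rwa [lam_lam ha hx] at this

/-- Residuation: truncated subtraction is left adjoint to `⊕ₑ`. -/
theorem lam_oplus_le_iff {a v x y : M} (ha : IsIdem a) (hv : v ≤ a) (hx : x ≤ a) (hy : y ≤ a) :
    lam a (lam a v ⊕ₑ x) ≤ y ↔ v ≤ x ⊕ₑ y := by
  have hv' := lam_le ha hv
  rw [lam_le_iff ha (oplus_le ha hv' hx) hy, oplus_comm (lam a v) x, ← oplus_assoc,
    ← lam_le_iff ha hv' (oplus_le ha hy hx), lam_lam ha hv, oplus_comm y x]

/-- Inside an interval `[0, a]`, adding `x` is a right adjoint by residuation, hence preserves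
meets. -/
theorem oplus_inf (x y z : M) : x ⊕ₑ (y ⊓ z) = (x ⊕ₑ y) ⊓ (x ⊕ₑ z) := by
  apply le_antisymm
  · exact le_inf (oplus_mono_right inf_le_left) (oplus_mono_right inf_le_right)
  · obtain ⟨a, ha, h1, h2⟩ := exists_idem_ge_pair (x ⊔ y) z
    have hx := le_sup_left.trans h1
    have hy := le_sup_right.trans h1
    have hv : (x ⊕ₑ y) ⊓ (x ⊕ₑ z) ≤ a := inf_le_left.trans (oplus_le ha hx hy)
    rw [← lam_oplus_le_iff ha hv hx (inf_le_left.trans hy)]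
    exact le_inf ((lam_oplus_le_iff ha hv hx hy).2 inf_le_left)
      ((lam_oplus_le_iff ha hv hx h2).2 inf_le_right)

theorem oplus_inf_le (z w c : M) : (z ⊕ₑ w) ⊓ c ≤ (z ⊓ c) ⊕ₑ (w ⊓ c) := by
  rw [oplus_inf, oplus_comm (z ⊓ c) w, oplus_comm (z ⊓ c) c, oplus_inf, oplus_inf]
  refine le_inf (le_inf ?_ ?_) (le_inf ?_ ?_)
  · rw [oplus_comm w z]; exact inf_le_left
  · exact inf_le_right.trans (le_oplus_right w c)
  · exact inf_le_right.trans (le_oplus_left c z)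
  · exact inf_le_right.trans (le_oplus_left c c)

theorem sumDefined_iff {a x y : M} (ha : IsIdem a) (hx : x ≤ a) (hy : y ≤ a) :
    SumDefined x y ↔ y ≤ lam a x := by
  have hx' := lam_le ha hx
  have hy' := lam_le ha hy
  have h : y ≤ lam a x ↔ lam a x ⊕ₑ lam a y = a := by
    rw [← lam_le_iff ha hy' hx', lam_lam ha hy]
  rw [SumDefined, odot_eq ha hx hy, h]
  constructor
  · intro h0
    rw [← lam_lam ha (oplus_le ha hx' hy'), h0, lam_zero ha]
  · intro h0
    rw [h0, lam_top]

theorem SumDefined.mono {x y x' y' : M} (h : SumDefined x y) (hx : x' ≤ x) (hy : y' ≤ y) :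
    SumDefined x' y' := by
  obtain ⟨a, ha, hxa, hya⟩ := exists_idem_ge_pair x y
  rw [sumDefined_iff ha hxa hya] at h
  rw [sumDefined_iff ha (hx.trans hxa) (hy.trans hya)]
  exact hy.trans (h.trans (lam_anti ha hx hxa))

theorem sumDefined_lam {a x : M} (ha : IsIdem a) (hx : x ≤ a) : SumDefined (lam a x) x :=
  (sumDefined_iff ha (lam_le ha hx) hx).2 (lam_lam ha hx).ge

/-- The witness is the truncated difference of `y` and `x`. The Łukasiewicz axiom turns its sum with
`x` into `y ⊕ₑ lam a (y ⊕ₑ lam a x)`, whose second term is zero as `x ≤ y`. -/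
theorem exists_sub {x y : M} (h : x ≤ y) : ∃ w, SumDefined x w ∧ x ⊕ₑ w = y := by
  obtain ⟨a, ha, hy⟩ := exists_idem_ge y
  have hx := h.trans hy
  have hy' := lam_le ha hy
  have hs := oplus_le ha hx hy'
  refine ⟨lam a (x ⊕ₑ lam a y), ?_, ?_⟩
  · exact (sumDefined_iff ha hx (lam_le ha hs)).2 (lam_anti ha (le_oplus_left _ _) hs)
  · have h1 := (isMVAlgebraOn a ha).lukasiewicz x (mem hx) y (mem hy)
    have h2 : y ⊕ₑ lam a x = a := (lam_le_iff ha (lam_le ha hx) hy).1 (by rwa [lam_lam ha hx])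
    rw [h1, h2, lam_top, oplus_zero]

theorem eq_zero_of_oplus_eq_left {m v : M} (h : SumDefined m v) (hm : m ⊕ₑ v = m) :
    v = zero := by
  obtain ⟨a, ha, hma, hva⟩ := exists_idem_ge_pair m v
  rw [sumDefined_iff ha hma hva] at h
  have hv' := lam_le ha hva
  have h1 := (isMVAlgebraOn a ha).lukasiewicz m (mem hma) (lam a v) (mem hv')
  have h2 : lam a v ⊕ₑ lam a m = a := by
    rw [oplus_comm]
    exact (lam_le_iff ha hv' (lam_le ha hma)).1 (by rwa [lam_lam ha hva])
  rw [lam_lam ha hva, hm, h2, lam_top, oplus_zero, oplus_comm, lam_oplus ha hma] at h1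
  rw [← lam_lam ha hva, ← h1, lam_top]

/-- Two elements have disjoint remainders over their meet. -/
theorem exists_disjoint_sub (x y : M) : ∃ d e, d ⊓ e = zero ∧
    SumDefined (x ⊓ y) d ∧ (x ⊓ y) ⊕ₑ d = x ∧ SumDefined (x ⊓ y) e ∧ (x ⊓ y) ⊕ₑ e = y := by
  obtain ⟨d, hd, hdx⟩ := exists_sub (inf_le_left : x ⊓ y ≤ x)
  obtain ⟨e, he, hey⟩ := exists_sub (inf_le_right : x ⊓ y ≤ y)
  refine ⟨d, e, ?_, hd, hdx, he, hey⟩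
  -- Adding `d ⊓ e` to `x ⊓ y` gives `x ⊓ y` back, by distributivity over meets; cancellation then
  -- applies.
  refine eq_zero_of_oplus_eq_left (hd.mono le_rfl inf_le_left) ?_
  rw [oplus_inf, hdx, hey]

/-- Rewrites a total sum as a partial one, so that additivity of states can be applied to it. -/
theorem oplus_eq_oplus_inf_lam {a x y : M} (ha : IsIdem a) (hx : x ≤ a) (hy : y ≤ a) :
    SumDefined x (y ⊓ lam a x) ∧ x ⊕ₑ (y ⊓ lam a x) = x ⊕ₑ y := by
  refine ⟨(sumDefined_iff ha hx (inf_le_left.trans hy)).2 inf_le_right, ?_⟩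
  rw [oplus_inf, oplus_comm x (lam a x), lam_oplus ha hx, inf_eq_left.2 (oplus_le ha hx hy)]

theorem lam_sup {a x y : M} (ha : IsIdem a) (hx : x ≤ a) (hy : y ≤ a) :
    lam a (x ⊔ y) = lam a x ⊓ lam a y := by
  apply le_antisymm
  · exact le_inf (lam_anti ha le_sup_left (sup_le hx hy)) (lam_anti ha le_sup_right (sup_le hx hy))
  · have h : lam a x ⊓ lam a y ≤ a := inf_le_left.trans (lam_le ha hx)
    exact le_lam_comm ha h (sup_le (le_lam_comm ha hx inf_le_left) (le_lam_comm ha hy inf_le_right))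

/-- Iterated doubling: `dbl x n` is the `2 ^ n`-fold sum of `x`. -/
def dbl (x : M) : ℕ → M
  | 0 => x
  | n + 1 => dbl x n ⊕ₑ dbl x n

theorem dbl_monotone (x : M) : Monotone (dbl x) :=
  monotone_nat_of_le_succ fun n => le_oplus_left (dbl x n) (dbl x n)

theorem dbl_le {a x : M} (ha : IsIdem a) (hx : x ≤ a) (n : ℕ) : dbl x n ≤ a := by
  induction n with
  | zero => exact hx
  | succ n ih => exact oplus_le ha ih ih

theorem dbl_inf_eq_zero {x y : M} (h : x ⊓ y = zero) (n : ℕ) : dbl x n ⊓ y = zero := by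
  induction n with
  | zero => exact h
  | succ n ih =>
    apply eq_zero_of_le
    calc dbl x (n + 1) ⊓ y ≤ (dbl x n ⊓ y) ⊕ₑ (dbl x n ⊓ y) := oplus_inf_le _ _ _
      _ = zero := by rw [ih, oplus_zero]

/-! ### Ideals, and primeness of maximal ideals -/

theorem IsIdeal.zero_mem {I : Set M} (hI : IsIdeal I) : zero ∈ I := by
  obtain ⟨x, hx⟩ := hI.nonempty
  exact hI.lower _ _ (zero_le x) hx

theorem IsIdeal.dbl_mem {I : Set M} (hI : IsIdeal I) {x : M} (hx : x ∈ I) (n : ℕ) :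
    dbl x n ∈ I := by
  induction n with
  | zero => exact hx
  | succ n ih => exact hI.oplus_mem _ _ ih ih

/-- The ideal generated by an ideal and an element. -/
theorem IsIdeal.adjoin {I : Set M} (hI : IsIdeal I) (x : M) :
    IsIdeal {y : M | ∃ i ∈ I, ∃ n, y ≤ i ⊕ₑ dbl x n} := by
  refine ⟨⟨zero, zero, hI.zero_mem, 0, zero_le _⟩, ?_, ?_⟩
  · rintro y z hyz ⟨i, hi, n, h⟩
    exact ⟨i, hi, n, hyz.trans h⟩
  · rintro y z ⟨i, hi, n, h⟩ ⟨j, hj, m, h'⟩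
    -- The extra `+ 1` absorbs the sum of two copies of `dbl x (max n m)`.
    refine ⟨i ⊕ₑ j, hI.oplus_mem _ _ hi hj, max n m + 1, ?_⟩
    calc y ⊕ₑ z ≤ (i ⊕ₑ dbl x (max n m)) ⊕ₑ (j ⊕ₑ dbl x (max n m)) :=
          oplus_mono_both (h.trans (oplus_mono_right (dbl_monotone x (le_max_left n m))))
            (h'.trans (oplus_mono_right (dbl_monotone x (le_max_right n m))))
      _ = (i ⊕ₑ j) ⊕ₑ (dbl x (max n m) ⊕ₑ dbl x (max n m)) := by
        rw [oplus_assoc, ← oplus_assoc (dbl x (max n m)) j, oplus_comm (dbl x (max n m)) j,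
          oplus_assoc j, ← oplus_assoc]

/-- Maximal ideals are prime. -/
theorem IsMaximalIdeal.mem_or_mem {I : Set M} (hI : IsMaximalIdeal I) {x y : M}
    (h : x ⊓ y = zero) : x ∈ I ∨ y ∈ I := by
  by_contra! hxy
  have hadj := hI.isIdeal.adjoin x
  have hsub : I ⊆ {y : M | ∃ i ∈ I, ∃ n, y ≤ i ⊕ₑ dbl x n} :=
    fun i hi => ⟨i, hi, 0, le_oplus_left _ _⟩
  have huniv : {y : M | ∃ i ∈ I, ∃ n, y ≤ i ⊕ₑ dbl x n} = Set.univ := by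
    by_contra hne
    refine hxy.1 ?_
    rw [← hI.eq_of_subset _ hadj hne hsub]
    exact ⟨zero, hI.isIdeal.zero_mem, 0, le_oplus_right _ _⟩
  obtain ⟨i, hi, n, hy⟩ := huniv.ge (Set.mem_univ y)
  refine hxy.2 (hI.isIdeal.lower _ _ ?_ hi)
  calc y ≤ (i ⊕ₑ dbl x n) ⊓ y := le_inf hy le_rfl
    _ ≤ (i ⊓ y) ⊕ₑ (dbl x n ⊓ y) := oplus_inf_le _ _ _
    _ = i ⊓ y := by rw [dbl_inf_eq_zero h, oplus_zero]
    _ ≤ i := inf_le_left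

end Arithmetic

theorem mem_ker_iff {M : Type*} {s : M → unitInterval} {x : M} :
    x ∈ ker s ↔ (s x : ℝ) = 0 :=
  Subtype.ext_iff

/-! ### States, additive maps below a state, and extremality -/

section Additive

variable {M : Type*} [EMVAlgebra M]

/-- Real-valued maps that are additive with respect to the partial sum. -/
def IsAdditive (f : M → ℝ) : Prop :=
  ∀ x y : M, SumDefined x y → f (x ⊕ₑ y) = f x + f y

namespace IsAdditive

variable {f : M → ℝ}

theorem zero_eq (hf : IsAdditive f) : f zero = 0 := by
  have h := hf zero zero ((sumDefined_iff isIdem_zero le_rfl le_rfl).2 (zero_le _))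
  rw [oplus_zero] at h
  linarith

theorem lam_add (hf : IsAdditive f) {a x : M} (ha : IsIdem a) (hx : x ≤ a) :
    f (lam a x) + f x = f a := by
  rw [← hf _ _ (sumDefined_lam ha hx), lam_oplus ha hx]

theorem mono (hf : IsAdditive f) (h0 : ∀ x, 0 ≤ f x) : Monotone f := by
  intro x y h
  obtain ⟨w, hw, rfl⟩ := exists_sub h
  rw [hf _ _ hw]
  linarith [h0 w]

theorem oplus_le_add (hf : IsAdditive f) (h0 : ∀ x, 0 ≤ f x) (x y : M) :
    f (x ⊕ₑ y) ≤ f x + f y := by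
  obtain ⟨a, ha, hx, hy⟩ := exists_idem_ge_pair x y
  obtain ⟨h1, h2⟩ := oplus_eq_oplus_inf_lam ha hx hy
  rw [← h2, hf _ _ h1]
  linarith [hf.mono h0 (inf_le_left : y ⊓ lam a x ≤ y)]

end IsAdditive

variable {s : M → unitInterval}

theorem isAdditive_of_mem_states (hs : s ∈ states M) : IsAdditive fun x => (s x : ℝ) := hs.1

theorem states_mono (hs : s ∈ states M) {x y : M} (h : x ≤ y) : (s x : ℝ) ≤ s y :=
  (isAdditive_of_mem_states hs).mono (fun x => (s x).2.1) h

theorem states_eq_one_of_le (hs : s ∈ states M) {x y : M} (h : x ≤ y) (hx : s x = 1) :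
    s y = 1 := by
  have := states_mono hs h
  rw [hx] at this
  exact le_antisymm (s y).2.2 this

theorem exists_idem_ge_eq_one (hs : s ∈ states M) (x y : M) :
    ∃ a : M, IsIdem a ∧ s a = 1 ∧ x ≤ a ∧ y ≤ a := by
  obtain ⟨b, hb⟩ := hs.2
  obtain ⟨a, ha, h1, h2⟩ := exists_idem_ge_pair (x ⊔ y) b
  exact ⟨a, ha, states_eq_one_of_le hs h2 hb, le_sup_left.trans h1, le_sup_right.trans h1⟩

theorem states_lam (hs : s ∈ states M) {a x : M} (ha : IsIdem a) (h1 : s a = 1) (hx : x ≤ a) :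
    (s (lam a x) : ℝ) = 1 - s x := by
  have h := (isAdditive_of_mem_states hs).lam_add ha hx
  simp only [h1, Set.Icc.coe_one] at h
  linarith

theorem isIdeal_ker (hs : s ∈ states M) : IsIdeal (ker s) := by
  have hadd := isAdditive_of_mem_states hs
  refine ⟨⟨zero, mem_ker_iff.2 hadd.zero_eq⟩, fun x y h hy => ?_, fun x y hx hy => ?_⟩
  · rw [mem_ker_iff] at *
    linarith [states_mono hs h, (s x).2.1]
  · rw [mem_ker_iff] at *
    linarith [hadd.oplus_le_add (fun x => (s x).2.1) x y, (s (x ⊕ₑ y)).2.1]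

/-- An additive map below a state is bounded by its value at any element of state one. -/
theorem IsAdditive.le_of_le_state {f : M → ℝ} (hf : IsAdditive f) (h0 : ∀ x, 0 ≤ f x)
    (hs : s ∈ states M) (hfs : ∀ x, f x ≤ s x) {a : M} (ha : s a = 1) (x : M) : f x ≤ f a := by
  obtain ⟨b, -, hb, hxb, hab⟩ := exists_idem_ge_eq_one hs x a
  refine (hf.mono h0 hxb).trans ?_
  -- The difference `w` of two elements of state one is null for `s`, hence for `f`.
  obtain ⟨w, hw, rfl⟩ := exists_sub hab
  have h := hs.1 _ _ hw
  rw [hb, ha] at h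
  rw [hf _ _ hw]
  linarith [hfs w]

/-- An extremal state dominates only its own multiples. -/
theorem exists_eq_mul_of_le (hs : s ∈ extremalStates M) {f : M → ℝ} (hf : IsAdditive f)
    (h0 : ∀ x, 0 ≤ f x) (hfs : ∀ x, f x ≤ s x) : ∃ t : ℝ, ∀ x, f x = t * s x := by
  obtain ⟨hst, hext⟩ := hs
  obtain ⟨a, ha⟩ := hst.2
  have hg : IsAdditive fun x => s x - f x := by
    intro x y h
    dsimp only
    rw [hst.1 x y h, hf x y h]
    ring
  have hg0 : ∀ x, 0 ≤ s x - f x := fun x => by linarith [hfs x]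
  have hfa := hf.le_of_le_state h0 hst hfs ha
  have hga := hg.le_of_le_state hg0 hst (fun x => by linarith [h0 x]) ha
  simp only [ha, Set.Icc.coe_one] at hga
  have hfa1 : f a ≤ 1 := (hfs a).trans (s a).2.2
  refine ⟨f a, fun x => ?_⟩
  -- `f a` is the largest value of `f`, and `1 - f a` that of `s - f`. If either is zero, that map
  -- vanishes; otherwise normalizing both exhibits `s` as a proper convex combination of states.
  rcases (h0 a).eq_or_lt with h | hpos
  · rw [← h]
    linarith [h0 x, hfa x]
  rcases hfa1.eq_or_lt with h | hlt
  · rw [h]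
    linarith [hga x, hg0 x]
  have hlt' : 0 < 1 - f a := by linarith
  have key := hext
    (fun x => ⟨f x / f a, div_nonneg (h0 x) hpos.le, (div_le_one hpos).2 (hfa x)⟩)
    ⟨fun x y h => by simp only; rw [hf x y h, add_div], a, by ext; simp [hpos.ne']⟩
    (fun x => ⟨(s x - f x) / (1 - f a), div_nonneg (hg0 x) hlt'.le, (div_le_one hlt').2 (hga x)⟩)
    ⟨fun x y h => by simp only; rw [hst.1 x y h, hf x y h]; ring,
      a, by ext; simp [ha, hlt'.ne']⟩
    (f a) ⟨hpos, hlt⟩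
    (fun x => by simp only; rw [mul_div_cancel₀ _ hpos.ne', mul_div_cancel₀ _ hlt'.ne']; ring)
  have hx : (s x : ℝ) = f x / f a := congrArg Subtype.val (congrFun key.1 x)
  rw [hx, mul_div_cancel₀ _ hpos.ne']

/-- The component of a state along an element `x`. -/
theorem exists_component (hs : s ∈ states M) (x : M) : ∃ f : M → ℝ, IsAdditive f ∧
    (∀ z, 0 ≤ f z) ∧ (∀ z, f z ≤ s z) ∧ f x = s x ∧ ∀ y, x ⊓ y = zero → f y = 0 := by
  have hadd := isAdditive_of_mem_states hs
  -- The component at `z` is the limit of the increasing bounded sequence `s (dbl x n ⊓ z)`.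
  have hlim : ∀ z, ∃ l : ℝ, Tendsto (fun n => (s (dbl x n ⊓ z) : ℝ)) atTop (𝓝 l) := by
    intro z
    refine ⟨_, tendsto_atTop_ciSup (fun n m h => states_mono hs
      (inf_le_inf_right z (dbl_monotone x h))) ⟨1, ?_⟩⟩
    rintro _ ⟨n, rfl⟩
    exact (s (dbl x n ⊓ z)).2.2
  choose f hf using hlim
  refine ⟨f, fun z w h => ?_, fun z => ?_, fun z => ?_, ?_, fun y hy => ?_⟩
  · apply le_antisymm
    · refine le_of_tendsto_of_tendsto' (hf _) ((hf z).add (hf w)) fun n => ?_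
      have h1 := oplus_inf_le z w (dbl x n)
      rw [inf_comm, inf_comm z, inf_comm w] at h1
      exact (states_mono hs h1).trans (hadd.oplus_le_add (fun x => (s x).2.1) _ _)
    -- The sum of the two truncations at `dbl x n` lies below `dbl x (n + 1)`, hence the index shift
    -- in the second limit.
    · refine le_of_tendsto_of_tendsto' ((hf z).add (hf w))
        ((hf (z ⊕ₑ w)).comp (tendsto_add_atTop_nat 1)) fun n => ?_
      rw [← hs.1 _ _ (h.mono inf_le_right inf_le_right)]
      exact states_mono hs (le_inf (oplus_mono_both inf_le_left inf_le_left)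
        (oplus_mono_both inf_le_right inf_le_right))
  · exact ge_of_tendsto' (hf z) fun n => (s _).2.1
  · exact le_of_tendsto' (hf z) fun n => states_mono hs inf_le_right
  · refine tendsto_nhds_unique (hf x) (tendsto_const_nhds.congr fun n => ?_)
    rw [inf_eq_right.2 (show x ≤ dbl x n from dbl_monotone x (Nat.zero_le n))]
  · refine tendsto_nhds_unique (hf y) (tendsto_const_nhds.congr fun n => ?_)
    rw [dbl_inf_eq_zero hy n]
    exact hadd.zero_eq.symm

theorem eq_zero_or_eq_zero_of_extremal (hs : s ∈ extremalStates M) {x y : M}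
    (h : x ⊓ y = zero) : s x = 0 ∨ s y = 0 := by
  obtain ⟨f, hf, h0, hfs, hx, hy⟩ := exists_component hs.1 x
  obtain ⟨t, ht⟩ := exists_eq_mul_of_le hs hf h0 hfs
  by_contra! hne
  have hsx : (s x : ℝ) ≠ 0 := fun h' => hne.1 (mem_ker_iff.2 h')
  have hsy : (s y : ℝ) ≠ 0 := fun h' => hne.2 (mem_ker_iff.2 h')
  have h1 := ht x
  have h2 := ht y
  rw [hy y h, eq_comm, mul_eq_zero, or_iff_left hsy] at h2
  rw [hx, h2, zero_mul] at h1
  exact hsx h1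

end Additive

/-! ### State-morphisms, prime kernels and maximal kernels -/

section Morphisms

variable {M : Type*} [EMVAlgebra M] {s : M → unitInterval}

theorem coe_inf_of_prime (hs : s ∈ states M)
    (hp : ∀ x y : M, x ⊓ y = zero → s x = 0 ∨ s y = 0) (x y : M) :
    (s (x ⊓ y) : ℝ) = min (s x : ℝ) (s y) := by
  obtain ⟨d, e, hde, hd, hdx, he, hey⟩ := exists_disjoint_sub x y
  have h1 := hs.1 _ _ hd
  have h2 := hs.1 _ _ he
  rw [hdx] at h1
  rw [hey] at h2
  rcases hp d e hde with h | h
  · rw [h, Set.Icc.coe_zero, add_zero] at h1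
    rw [h1, min_eq_left]
    linarith [(s e).2.1]
  · rw [h, Set.Icc.coe_zero, add_zero] at h2
    rw [h2, min_eq_right]
    linarith [(s d).2.1]

/-- A state with prime kernel is a state-morphism. -/
theorem mem_stateMorphisms_of_prime (hs : s ∈ states M)
    (hp : ∀ x y : M, x ⊓ y = zero → s x = 0 ∨ s y = 0) : s ∈ stateMorphisms M := by
  have hinf := coe_inf_of_prime hs hp
  have hadd : ∀ x y : M, s (x ⊕ₑ y) = s x ⊕ₑ s y := by
    intro x y
    obtain ⟨a, ha, h1, hx, hy⟩ := exists_idem_ge_eq_one hs x y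
    obtain ⟨h2, h3⟩ := oplus_eq_oplus_inf_lam ha hx hy
    ext
    rw [← h3, hs.1 _ _ h2, hinf, states_lam hs ha h1 hx, coe_oplus, ← min_add_add_left]
    congr 1
    ring
  refine ⟨⟨fun x y => ?_, fun x y => ?_, hadd, ?_, fun b x hb hx => ?_⟩, hs.2⟩
  -- Joins reduce to meets by De Morgan in an interval `[0, a]` with `s a = 1`.
  · obtain ⟨a, ha, h1, hx, hy⟩ := exists_idem_ge_eq_one hs x y
    have h := hinf (lam a x) (lam a y)
    rw [← lam_sup ha hx hy, states_lam hs ha h1 (sup_le hx hy), states_lam hs ha h1 hx,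
      states_lam hs ha h1 hy, min_sub_sub_left] at h
    ext
    refine Eq.trans ?_ (Subtype.mono_coe _).map_max.symm
    linarith
  · ext
    exact (hinf x y).trans (Subtype.mono_coe _).map_min.symm
  · exact mem_ker_iff.2 (isAdditive_of_mem_states hs).zero_eq
  · have hsb : IsIdem (s b) := by rw [IsIdem, ← hadd, hb]
    rcases unit_idem hsb with h | h
    · have h1 : s (lam b x) = 0 := (isIdeal_ker hs).lower _ _ (lam_le hb hx) h
      have h2 : s x = 0 := (isIdeal_ker hs).lower _ _ hx h
      rw [h1, h2, h, unit_lam_zero]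
    · rw [h, unit_lam_one]
      ext
      rw [states_lam hs hb h hx, unitInterval.coe_symm_eq]

theorem coe_oplus_of_mem_stateMorphisms (hs : s ∈ stateMorphisms M) (x y : M) :
    (s (x ⊕ₑ y) : ℝ) = min ((s x : ℝ) + s y) 1 := by
  rw [hs.1.map_oplus, coe_oplus]

theorem coe_inf_of_mem_stateMorphisms (hs : s ∈ stateMorphisms M) (x y : M) :
    (s (x ⊓ y) : ℝ) = min (s x : ℝ) (s y) := by
  rw [hs.1.map_inf]
  exact (Subtype.mono_coe _).map_min

/-- If the partial sum is defined, then `s y ≤ 1 - s x`, so the truncation at 1 in `[0, 1]` has no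
effect. -/
theorem stateMorphisms_subset_states : stateMorphisms M ⊆ states M := by
  intro s hs
  refine ⟨fun x y h => ?_, hs.2⟩
  obtain ⟨b, hb⟩ := hs.2
  obtain ⟨a, ha, h1, hba⟩ := exists_idem_ge_pair (x ⊔ y) b
  have hx := le_sup_left.trans h1
  have hy := le_sup_right.trans h1
  have hsa : s a = 1 := by
    have h2 := hs.1.map_sup b a
    rw [sup_eq_right.2 hba, hb] at h2
    rw [h2]
    exact sup_eq_left.2 unitInterval.le_one'
  rw [sumDefined_iff ha hx hy] at h
  have h3 := hs.1.map_inf y (lam a x)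
  rw [inf_eq_left.2 h, hs.1.map_lam a x ha hx, hsa, unit_lam_one] at h3
  have h4 : s y ≤ unitInterval.symm (s x) := inf_eq_left.1 h3.symm
  rw [← Subtype.coe_le_coe, unitInterval.coe_symm_eq] at h4
  rw [coe_oplus_of_mem_stateMorphisms hs, min_eq_left]
  linarith

/-- A state vanishing on the kernel of a state-morphism equals that state-morphism. -/
theorem eq_of_ker_subset (hs : s ∈ stateMorphisms M) {s' : M → unitInterval}
    (hs' : s' ∈ states M) (hker : ker s ⊆ ker s') : s = s' := by
  have hst := stateMorphisms_subset_states hs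
  -- Doubling an element doubles the discrepancy of the two states, which never exceeds 1; hence it
  -- is zero.
  have key : ∀ (n : ℕ) (x : M), 2 ^ n * |(s x : ℝ) - s' x| ≤ 1 := by
    intro n
    induction n with
    | zero =>
      intro x
      rw [pow_zero, one_mul, abs_le]
      constructor <;> linarith [(s x).2.1, (s x).2.2, (s' x).2.1, (s' x).2.2]
    | succ n ih =>
      -- When `s x ≤ 1 / 2`, the remainder `w` of `x` over `x ⊓ lam a x` is null for `s`, hence for
      -- `s'`, so both states take exactly twice their value at `x ⊕ₑ x`.
      have small : ∀ x : M, (s x : ℝ) ≤ 1 / 2 → 2 ^ (n + 1) * |(s x : ℝ) - s' x| ≤ 1 := by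
        intro x hx
        obtain ⟨a, ha, h1, hxa, -⟩ := exists_idem_ge_eq_one hst x x
        obtain ⟨h2, h3⟩ := oplus_eq_oplus_inf_lam ha hxa hxa
        obtain ⟨w, hw, hwx⟩ := exists_sub (inf_le_left : x ⊓ lam a x ≤ x)
        have e1 := hst.1 _ _ hw
        have e2 := hs'.1 _ _ hw
        have e3 := hst.1 _ _ h2
        have e4 := hs'.1 _ _ h2
        rw [hwx] at e1 e2
        rw [h3] at e3 e4
        have e5 := coe_inf_of_mem_stateMorphisms hs x (lam a x)
        rw [states_lam hst ha h1 hxa, min_eq_left (by linarith)] at e5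
        have e6 := mem_ker_iff.1 (hker (mem_ker_iff.2 (by linarith : (s w : ℝ) = 0)))
        have e7 := ih (x ⊕ₑ x)
        have e8 : (s (x ⊕ₑ x) : ℝ) - s' (x ⊕ₑ x) = 2 * ((s x : ℝ) - s' x) := by linarith
        rw [e8, abs_mul, abs_two] at e7
        rw [pow_succ, mul_assoc]
        exact e7
      intro x
      rcases le_total (s x : ℝ) (1 / 2) with h | h
      · exact small x h
      -- Complementing in an interval whose top has value one under both states preserves the
      -- discrepancy and brings `s` down to at most `1 / 2`.
      · obtain ⟨b, -, h1, hxb, -⟩ := exists_idem_ge_eq_one hst x x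
        obtain ⟨a, ha, h1', hba, -⟩ := exists_idem_ge_eq_one hs' b b
        have hxa := hxb.trans hba
        have e := small (lam a x)
        rw [states_lam hst ha (states_eq_one_of_le hst hba h1) hxa,
          states_lam hs' ha h1' hxa, sub_sub_sub_cancel_left, abs_sub_comm] at e
        exact e (by linarith)
  funext x
  by_contra hne
  have hpos : 0 < |(s x : ℝ) - s' x| :=
    abs_pos.2 (sub_ne_zero.2 fun h => hne (Subtype.ext h))
  obtain ⟨n, hn⟩ := pow_unbounded_of_one_lt (|(s x : ℝ) - s' x|)⁻¹ (one_lt_two : (1 : ℝ) < 2)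
  rw [inv_lt_iff_one_lt_mul₀ hpos] at hn
  linarith [key n x]

theorem stateMorphisms_subset_extremalStates : stateMorphisms M ⊆ extremalStates M := by
  intro s hs
  refine ⟨stateMorphisms_subset_states hs, fun s₁ h₁ s₂ h₂ t ht h => ?_⟩
  have ht' : 0 < 1 - t := sub_pos.2 ht.2
  refine ⟨eq_of_ker_subset hs h₁ fun x hx => ?_, eq_of_ker_subset hs h₂ fun x hx => ?_⟩
  all_goals
    rw [mem_ker_iff] at *
    have e := h x
    have e1 := mul_nonneg ht.1.le (s₁ x).2.1
    have e2 := mul_nonneg ht'.le (s₂ x).2.1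
  · exact (mul_eq_zero.1 (by linarith : t * (s₁ x : ℝ) = 0)).resolve_left ht.1.ne'
  · exact (mul_eq_zero.1 (by linarith : (1 - t) * (s₂ x : ℝ) = 0)).resolve_left ht'.ne'

theorem min_le_coe_dbl (hs : s ∈ stateMorphisms M) (x : M) (n : ℕ) :
    min (2 ^ n * (s x : ℝ)) 1 ≤ s (dbl x n) := by
  induction n with
  | zero => rw [pow_zero, one_mul]; exact min_le_left _ _
  | succ n ih =>
    rw [dbl, coe_oplus_of_mem_stateMorphisms hs, pow_succ]
    rcases min_le_iff.1 ih with h | h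
    · exact min_le_min_right _ (by linarith)
    · exact (min_le_right _ _).trans (le_min (by linarith [(s (dbl x n)).2.1]) le_rfl)

/-- If `z` is not in the kernel, some `dbl z n` has value 1, so its complement in `[0, b]` lies in
the kernel when `s b = 1`. An ideal containing the kernel and `z` thus contains `b`, which can be
taken above any given element. -/
theorem isMaximalIdeal_ker (hs : s ∈ stateMorphisms M) : IsMaximalIdeal (ker s) := by
  have hst := stateMorphisms_subset_states hs
  refine ⟨isIdeal_ker hst, fun h => ?_, fun J hJ hne hsub => ?_⟩
  · obtain ⟨a, ha⟩ := hs.2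
    have h0 : s a = 0 := h.ge (Set.mem_univ a)
    exact zero_ne_one (h0.symm.trans ha)
  · refine Set.Subset.antisymm (fun z hz => ?_) hsub
    by_contra hz0
    rw [mem_ker_iff] at hz0
    have hpos : 0 < (s z : ℝ) := lt_of_le_of_ne (s z).2.1 (Ne.symm hz0)
    obtain ⟨n, hn⟩ := pow_unbounded_of_one_lt (s z : ℝ)⁻¹ (one_lt_two : (1 : ℝ) < 2)
    rw [inv_lt_iff_one_lt_mul₀ hpos] at hn
    have hdbl := min_le_coe_dbl hs z n
    rw [min_eq_right hn.le] at hdbl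
    refine hne (Set.eq_univ_of_forall fun x => ?_)
    obtain ⟨b, hb, hb1, hxb, hzb⟩ := exists_idem_ge_eq_one hst x z
    have hle := dbl_le hb hzb n
    have hlam : lam b (dbl z n) ∈ ker s := by
      rw [mem_ker_iff]
      refine le_antisymm ?_ (s _).2.1
      rw [states_lam hst hb hb1 hle]
      linarith
    have hbJ := hJ.oplus_mem _ _ (hsub hlam) (hJ.dbl_mem hz n)
    rw [lam_oplus hb hle] at hbJ
    exact hJ.lower _ _ hxb hbJ

end Morphisms

end EMVAlgebra

theorem mainTheorem3 (M : Type*) [EMVAlgebra M] :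
    EMVAlgebra.extremalStates M = EMVAlgebra.stateMorphisms M ∧
      ∀ s ∈ EMVAlgebra.states M,
        (s ∈ EMVAlgebra.extremalStates M ↔ EMVAlgebra.IsMaximalIdeal (EMVAlgebra.ker s)) := by
  have heq : EMVAlgebra.extremalStates M = EMVAlgebra.stateMorphisms M :=
    Set.Subset.antisymm
      (fun _ hs => EMVAlgebra.mem_stateMorphisms_of_prime hs.1
        fun _ _ => EMVAlgebra.eq_zero_or_eq_zero_of_extremal hs)
      EMVAlgebra.stateMorphisms_subset_extremalStates
  refine ⟨heq, fun s hs => ⟨fun h => EMVAlgebra.isMaximalIdeal_ker (heq.le h), fun h => ?_⟩⟩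
  exact EMVAlgebra.stateMorphisms_subset_extremalStates
    (EMVAlgebra.mem_stateMorphisms_of_prime hs fun _ _ hxy => h.mem_or_mem hxy)
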